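/- Let $\Gamma$ be a profinite group, $p:\Gamma\to H$ a continuous homomorphism to a finite (discrete) group, and $f:G\to H$ a surjective homomorphism of finite groups with kernel $P$. Let $A$ be a finitely generated abelian group, $a\in A$, and suppose that $P$ is $A$-perfect, i.e. $P^{ab}\otimes_{\mathbb Z}A=0$. All homology of $P$ has trivial coefficients. $G$ acts on $P$ by conjugation, hence on $H_2(P,A)$; since $P$ acts trivially on $H_2(P,A)$, this action descends to $H$, and $\Gamma$ acts on $H_2(P,A)$ through $p$. For a group extension of $P$ by a central subgroup $N$, let $\delta:H_2(P,\mathbb Z)\to N$ be the image of its class under the map $H^2(P,N)\to\operatorname{Hom}(H_2(P,\mathbb Z),N)$ of the universal coefficient theorem. An *$a$-central extension* is a central extension $1\to H_2(P,A)\to C\xrightarrow{\pi}P\to1$ for which $\delta$ is the map $H_2(P,\mathbb Z)\to H_2(P,A)$ induced by $\mathbb Z\to A$, $1\mapsto a$. Then: 1. An $a$-central extension exists and is unique up to equivalence of extensions. 2. For every $a$-central extension there is a unique action of $G$ on $C$ by automorphisms that is compatible with the actions of $G$ on $P$ and on $H_2(P,A)$ and for which $d:C\xrightarrow{\pi}P\hookrightarrow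 G$ is a crossed module, that is, $d({}^gc)=g\,d(c)\,g^{-1}$ and ${}^{d(c)}c'=cc'c^{-1}$ for all $g\in G$ and $c,c'\in C$. 3. The crossed module $1\to H_2(P,A)\to C\xrightarrow{d}G\xrightarrow{f}H\to1$ is classified by a well-defined element $\tilde o_2^a\in H^3(H,H_2(P,A))$: for every set-theoretic section $s$ of $f$ and every $F:H\times H\to C$ with $s(h)s(k)=d(F(h,k))\,s(hk)$, the function $c:H^3\to H_2(P,A)$ given by ${}^{s(h)}F(k,l)\,F(h,kl)=c(h,k,l)\,F(h,k)\,F(hk,l)$ is a $3$-cocycle with class $\tilde o_2^a$, and this class does not depend on $s$, on $F$, or on the $a$-central extension. 4. If $f$ has a section that is a group homomorphism, then $\tilde o_2^a=0$. 5. Let $o_2^a=p^*(\tilde o_2^a)\in H^3(\Gamma,H_2(P,A))$ (continuous cohomology, $H_2(P,A)$ discrete). If the embedding problem $(p,f)$ has a weak solution, i.e. there is a continuous homomorphism $q:\Gamma\to G$ with $f\circ q=p$, then $o_2^a=0$. Equivalently, if $o_2^a\neq0$, the embedding problem has no solutions. -/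

import Mathlib

open CategoryTheory TensorProduct

universe v

/-- The group `P` is `A`-perfect if `Pᵃᵇ ⊗ A = 0`. -/
def IsAPerfect (P A : Type*) [Group P] [AddCommGroup A] : Prop :=
  Subsingleton (Additive (Abelianization P) ⊗[ℤ] A)

/-! ### The second homology group `H₂(P, A)` -/

/-- The second homology group `H₂(P, A)` with trivial coefficients `A`. -/
def HTwo (P A : Type) [Group P] [AddCommGroup A] : Type :=
  groupHomology.H2 (Rep.trivial ℤ P A)

noncomputable instance (P A : Type) [Group P] [AddCommGroup A] : AddCommGroup (HTwo P A) :=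
  inferInstanceAs (AddCommGroup (groupHomology.H2 (Rep.trivial ℤ P A)))

/-- `H₂(P, A)` carries the discrete topology. -/
instance (P A : Type) [Group P] [AddCommGroup A] : TopologicalSpace (HTwo P A) := ⊥

instance (P A : Type) [Group P] [AddCommGroup A] : DiscreteTopology (HTwo P A) := ⟨rfl⟩

noncomputable section

namespace HTwo

variable {P Q R : Type} [Group P] [Group Q] [Group R]
  {A B D : Type} [AddCommGroup A] [AddCommGroup B] [AddCommGroup D]

/-- The class in `H₂(P, A)` of a `2`-cycle of the bar complex. -/
def mk (x : groupHomology.cycles₂ (Rep.trivial ℤ P A)) : HTwo P A :=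
  (groupHomology.H2π (Rep.trivial ℤ P A)).hom x

/-- The map `H₂(P, A) → H₂(Q, B)` induced by `φ : P → Q` and `s : A → B`. -/
def map (φ : P →* Q) (s : A →+ B) : HTwo P A →+ HTwo Q B :=
  (groupHomology.map (A := Rep.trivial ℤ P A) (B := Rep.trivial ℤ Q B) φ
    (Rep.ofHom ⟨s.toIntLinearMap, fun _ => rfl⟩) 2).hom.toAddMonoidHom

lemma mk_surjective : Function.Surjective (mk : _ → HTwo P A) := fun x =>
  groupHomology.H2_induction_on (A := Rep.trivial ℤ P A) (C := fun x => ∃ y, mk y = x) x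
    fun y => ⟨y, rfl⟩

lemma map_id (x : HTwo P A) : map (MonoidHom.id P) (AddMonoidHom.id A) x = x := by
  have := congr(($(groupHomology.map_id (A := Rep.trivial ℤ P A) (n := 2))).hom x)
  exact this

lemma map_map (φ : P →* Q) (ψ : Q →* R) (s : A →+ B) (t : B →+ D) (x : HTwo P A) :
    map (ψ.comp φ) (t.comp s) x = map ψ t (map φ s x) := by
  have := congr(($(groupHomology.map_comp (A := Rep.trivial ℤ P A) (B := Rep.trivial ℤ Q B)
    (C := Rep.trivial ℤ R D) φ ψ (Rep.ofHom ⟨s.toIntLinearMap, fun _ => rfl⟩)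
    (Rep.ofHom ⟨t.toIntLinearMap, fun _ => rfl⟩) 2)).hom x)
  exact this

/-- Inner automorphisms act trivially on homology. -/
lemma map_conj (p : P) (x : HTwo P A) :
    map (MulAut.conj p).toMonoidHom (AddMonoidHom.id A) x = x := by
  obtain ⟨x, rfl⟩ := mk_surjective x
  let c : P → P := fun g => p * g * p⁻¹
  let S₂ : (P × P →₀ A) →ₗ[ℤ] (P × P × P →₀ A) := Finsupp.lsum ℤ fun gh =>
    Finsupp.lsingle (p, gh.1, gh.2) - Finsupp.lsingle (c gh.1, p, gh.2)
      + Finsupp.lsingle (c gh.1, c gh.2, p)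
  let S₁ : (P →₀ A) →ₗ[ℤ] (P × P →₀ A) := Finsupp.lsum ℤ fun g =>
    Finsupp.lsingle (p, g) - Finsupp.lsingle (c g, p)
  have e₂ (g h : P) (a : A) : (groupHomology.d₂₁ (Rep.trivial ℤ P A)).hom
      (Finsupp.single (g, h) a) =
        Finsupp.single h a - Finsupp.single (g * h) a + Finsupp.single g a :=
    groupHomology.d₂₁_single (A := Rep.trivial ℤ P A) (g, h) a
  have e₃ (g h j : P) (a : A) : (groupHomology.d₃₂ (Rep.trivial ℤ P A)).hom
      (Finsupp.single (g, h, j) a) =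
        Finsupp.single (h, j) a - Finsupp.single (g * h, j) a
          + Finsupp.single (g, h * j) a - Finsupp.single (g, h) a :=
    groupHomology.d₃₂_single (A := Rep.trivial ℤ P A) (g, h, j) a
  have key : ∀ y : P × P →₀ A,
      (groupHomology.chainsMap₂ (A := Rep.trivial ℤ P A) (B := Rep.trivial ℤ P A)
        (MulAut.conj p).toMonoidHom
        (Rep.ofHom ⟨(AddMonoidHom.id A).toIntLinearMap, fun _ => rfl⟩)).hom y - y =
      (groupHomology.d₃₂ (Rep.trivial ℤ P A)).hom (-S₂ y)
        - S₁ ((groupHomology.d₂₁ (Rep.trivial ℤ P A)).hom y) := by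
    intro y
    induction y using Finsupp.induction_linear with
    | zero => simp
    | add u v hu hv =>
      simp only [map_add, neg_add] at hu hv ⊢
      rw [add_sub_add_comm, hu, hv]
      abel
    | single gh a =>
      obtain ⟨g, h⟩ := gh
      have h1 : p * h * p⁻¹ * p = p * h := by group
      have h2 : p * g * p⁻¹ * p = p * g := by group
      have h3 : p * g * p⁻¹ * (p * h * p⁻¹) = p * (g * h) * p⁻¹ := by group
      have es₁ (g : P) : S₁ (Finsupp.single g a) =
          Finsupp.single (p, g) a - Finsupp.single (c g, p) a := by simp [S₁]
      have es₂ : S₂ (Finsupp.single (g, h) a) = Finsupp.single (p, g, h) a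
          - Finsupp.single (c g, p, h) a + Finsupp.single (c g, c h, p) a := by simp [S₂]
      simp only [es₂, e₂, e₃, map_neg, map_add, map_sub, es₁]
      simp [c, groupHomology.chainsMap₂, h3]
      abel
  have hx : (groupHomology.d₂₁ (Rep.trivial ℤ P A)).hom x.1 = 0 := x.2
  have h := congr(($(groupHomology.H2π_comp_map (A := Rep.trivial ℤ P A)
    (B := Rep.trivial ℤ P A) (MulAut.conj p).toMonoidHom
    (Rep.ofHom ⟨(AddMonoidHom.id A).toIntLinearMap, fun _ => rfl⟩))).hom x)
  refine Eq.trans h ((groupHomology.H2π_eq_iff (A := Rep.trivial ℤ P A) _ _).2 ?_)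
  refine ⟨-S₂ x.1, ?_⟩
  have := key x.1
  rw [hx, map_zero, sub_zero] at this
  exact this.symm

end HTwo

/-! ### The actions on `H₂(ker f, A)` -/

section action

variable {G : Type} [Group G] {H : Type*} [Group H] (f : G →* H) (A : Type) [AddCommGroup A]

/-- The action of `G` on `H₂(ker f, A)` induced by conjugation on the normal subgroup `ker f`. -/
def conjAction : G →* Module.End ℤ (HTwo f.ker A) where
  toFun g := (HTwo.map (MulAut.conjNormal g : MulAut f.ker).toMonoidHom
    (AddMonoidHom.id A)).toIntLinearMap
  map_one' := by
    ext x
    rw [map_one]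
    exact HTwo.map_id x
  map_mul' g g' := by
    ext x
    rw [map_mul]
    exact HTwo.map_map (MulAut.conjNormal g' : MulAut f.ker).toMonoidHom
      (MulAut.conjNormal g : MulAut f.ker).toMonoidHom (AddMonoidHom.id A) (AddMonoidHom.id A) x

lemma conjAction_ker (p : f.ker) : conjAction f A p = 1 := by
  ext x
  have h : (MulAut.conjNormal (p : G) : MulAut f.ker) = MulAut.conj p := by
    ext; simp
  change HTwo.map (MulAut.conjNormal (p : G) : MulAut f.ker).toMonoidHom _ x = x
  rw [h]
  exact HTwo.map_conj p x

/-- As `ker f` acts trivially on its homology, the conjugation action of `G` on `H₂(ker f, A)`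
descends to an action of `H`. -/
def outerAction (hf : Function.Surjective f) : H →* Module.End ℤ (HTwo f.ker A) :=
  (Units.coeHom _).comp (f.liftOfSurjective hf ⟨(conjAction f A).toHomUnits, fun p hp => by
    rw [MonoidHom.mem_ker]
    ext1
    exact conjAction_ker f A ⟨p, hp⟩⟩)

lemma outerAction_apply (hf : Function.Surjective f) (g : G) :
    outerAction f A hf (f g) = conjAction f A g := by
  simp [outerAction, MonoidHom.liftOfSurjective]

/-- The discrete `H`-module `H₂(ker f, A)`, lifted to the universe of `H`. -/
def coeffModule {H : Type v} [Group H] (f : G →* H) (A : Type) [AddCommGroup A]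
    (hf : Function.Surjective f) : TopRep.{v} ℤ H :=
  TopRep.of (X := ULift.{v} (HTwo f.ker A)) (ContRepresentation.ofMonoidHom
    { toFun h := ⟨(ULift.moduleEquiv.symm : _ ≃ₗ[ℤ] ULift.{v} (HTwo f.ker A)).toLinearMap ∘ₗ
        outerAction f A hf h ∘ₗ ULift.moduleEquiv.toLinearMap, continuous_of_discreteTopology⟩
      map_one' := by ext; simp
      map_mul' _ _ := by ext; simp })

end action

/-! ### Central extensions and the `a`-central extension -/

section extension

variable {M : Type*} [AddCommGroup M] {C : Type*} [Group C] {P : Type} [Group P]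

/-- `E` is a central extension. -/
def GroupExtension.IsCentral (E : GroupExtension (Multiplicative M) C P) : Prop :=
  E.inl.range ≤ Subgroup.center C

/-- `δ : H₂(P, ℤ) → M` is the image of the class of the central extension `E` under the map
`H²(P, M) → Hom(H₂(P, ℤ), M)` of the universal coefficient theorem: for every factor set
`z` of `E`, it sends the class of a cycle `∑ nᵢ [gᵢ|hᵢ]` to `∑ nᵢ z(gᵢ, hᵢ)`. -/
def GroupExtension.IsUniversalCoefficientImage (E : GroupExtension (Multiplicative M) C P)
    (δ : HTwo P ℤ →+ M) : Prop :=
  ∀ (σ : E.Section) (z : P → P → M),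
    (∀ g h, σ g * σ h = E.inl (Multiplicative.ofAdd (z g h)) * σ (g * h)) →
    ∀ x : groupHomology.cycles₂ (Rep.trivial ℤ P ℤ),
      δ (HTwo.mk x) = x.1.sum fun gh (n : ℤ) => n • z gh.1 gh.2

/-- `E` is an `a`-central extension of `P`: it is a central extension of `P` by `H₂(P, A)` whose
class corresponds to `H₂(P, ℤ) → H₂(P, A)`, the map induced by `ℤ → A`, `1 ↦ a`. -/
def IsACentralExtension {A : Type} [AddCommGroup A] (a : A)
    (E : GroupExtension (Multiplicative (HTwo P A)) C P) : Prop :=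
  E.IsCentral ∧
    E.IsUniversalCoefficientImage (HTwo.map (MonoidHom.id P) (zmultiplesHom A a))

end extension

/-! ### Crossed modules and their classes -/

/-- A homomorphism `d : C → G` and an action of `G` on `C` form a crossed module. -/
structure IsCrossedModule {C G : Type*} [Group C] [Group G] (d : C →* G) (act : G →* MulAut C) :
    Prop where
  equivariant : ∀ g c, d (act g c) = g * d c * g⁻¹
  peiffer : ∀ c c', act (d c) c' = c * c' * c⁻¹

/-- The homomorphism `d : C → P = ker f → G` attached to an extension `C` of `ker f`. -/
def boundary {N C G H : Type*} [Group N] [Group C] [Group G] [Group H] {f : G →* H}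
    (E : GroupExtension N C f.ker) : C →* G :=
  f.ker.subtype.comp E.rightHom

/-- The action of `G` on `C` is compatible with the conjugation action of `G` on `P = ker f` and
with the induced action of `G` on `H₂(P, A)`. -/
structure IsCompatibleAction {G : Type} {H C : Type*} [Group G] [Group H] [Group C] {f : G →* H}
    {A : Type} [AddCommGroup A] (E : GroupExtension (Multiplicative (HTwo f.ker A)) C f.ker)
    (act : G →* MulAut C) : Prop where
  rightHom_act : ∀ g c, E.rightHom (act g c) = MulAut.conjNormal g (E.rightHom c)
  act_inl : ∀ g m, act g (E.inl (Multiplicative.ofAdd m)) =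
    E.inl (Multiplicative.ofAdd (conjAction f A g m))

/-- `c` is a characteristic `3`-cocycle of the crossed module `d : C → G` with cokernel
`f : G → H` and kernel `ι : M → C`: for some set-theoretic section `s` of `f`, and some lift `F`
to `C` of the function `(h, k) ↦ s(h) s(k) s(hk)⁻¹`, it measures the failure of `F` to
be a (nonabelian) `2`-cocycle. -/
def IsCharacteristicCocycle {C G H M : Type*} [Group C] [Group G] [Group H] [AddCommGroup M]
    (ι : Multiplicative M →* C) (d : C →* G) (act : G →* MulAut C) (f : G →* H)
    (c : H → H → H → M) : Prop :=
  ∃ (s : H → G) (F : H → H → C), (∀ h, f (s h) = h) ∧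
    (∀ h k, s h * s k = d (F h k) * s (h * k)) ∧
    ∀ h k l, act (s h) (F k l) * F h (k * l) =
      ι (Multiplicative.ofAdd (c h k l)) * F h k * F (h * k) l

/-- The third continuous cohomology group `H³(Γ, X)` of a topological group. -/
abbrev HThree {Γ : Type v} [Group Γ] [TopologicalSpace Γ] [IsTopologicalGroup Γ]
    (X : TopRep.{v} ℤ Γ) : TopModuleCat.{v} ℤ :=
  continuousCohomology 3 X

/-- The element `x` of `H³(H, X)` is the class of the inhomogeneous `3`-cocycle `c`: it is
represented by the homogeneous cocycle
`(h₀, h₁, h₂, h₃) ↦ h₀ • c(h₀⁻¹h₁, h₁⁻¹h₂, h₂⁻¹h₃)`. -/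
def IsClassOfCocycle {H : Type v} [Group H] [TopologicalSpace H] [IsTopologicalGroup H]
    {X : TopRep.{v} ℤ H} (c : H → H → H → X) (x : HThree X) : Prop :=
  ∃ z : ContinuousCohomology.cocycles X 3, (ContinuousCohomology.π X 3).hom z = x ∧
    ∀ h₀ h₁ h₂ h₃ : H,
      ((((TopRep.homogeneousCochains X).iCycles 3).hom z).1 :
        C(H, C(H, C(H, C(H, X))))) h₀ h₁ h₂ h₃ =
      X.ρ h₀ (c (h₀⁻¹ * h₁) (h₁⁻¹ * h₂) (h₂⁻¹ * h₃))

/-- Let `E` be an extension of `ker f` by `H₂(ker f, A)`, and let `G` act on `C`. The element `x` of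
`H³(H, H₂(ker f, A))` classifies the crossed module `C → G`: there is a characteristic cocycle, and
each of them, whatever the choices made, is a `3`-cocycle with class `x`. -/
def IsClassifiedBy {G C : Type} {H : Type v} [Group G] [Group C] [Group H] [TopologicalSpace H]
    [IsTopologicalGroup H] {f : G →* H} (hf : Function.Surjective f) {A : Type} [AddCommGroup A]
    (E : GroupExtension (Multiplicative (HTwo f.ker A)) C f.ker) (act : G →* MulAut C)
    (x : HThree (coeffModule f A hf)) : Prop :=
  (∃ c, IsCharacteristicCocycle E.inl (boundary E) act f c) ∧
    ∀ c : H → H → H → HTwo f.ker A, IsCharacteristicCocycle E.inl (boundary E) act f c →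
      IsClassOfCocycle (X := coeffModule f A hf) (fun h k l => ULift.up (c h k l)) x

/-- The pullback `p* : H³(H, X) → H³(Γ, p*X)` on continuous cohomology. -/
def pullback {Γ H : Type v} [Group Γ] [TopologicalSpace Γ] [IsTopologicalGroup Γ] [Group H]
    [TopologicalSpace H] [IsTopologicalGroup H] (p : Γ →ₜ* H) (X : TopRep.{v} ℤ H)
    (x : HThree X) : HThree (TopRep.res (p : Γ →* H) X) :=
  (ContinuousCohomology.map p (𝟙 (TopRep.res (p : Γ →* H) X)) 3).hom x

/-- The embedding problem `(p : Γ → H, f : G → H)` has a weak solution. -/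
def HasWeakSolution {Γ G H : Type*} [Group Γ] [TopologicalSpace Γ] [Group G] [TopologicalSpace G]
    [Group H] [TopologicalSpace H] (p : Γ →ₜ* H) (f : G →* H) : Prop :=
  ∃ q : Γ →ₜ* G, ∀ γ, f (q γ) = p γ

end

/-!
Write `M = H₂(P, A)`. Since `Pᵃᵇ ⊗ A = 0` and both groups are finitely generated, their annihilators
in `ℤ` are comaximal (`IsAPerfect.exists_int`): some integer `n` annihilates `Pᵃᵇ` and acts as the
identity on `A`, hence on `M`. Such an `n` makes `Hom(P, M)` and `Ext(Pᵃᵇ, M)` vanish, so that the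
universal coefficient theorem identifies `H²(P, M)` with `Hom(H₂(P, ℤ), M)`. Surjectivity
(`exists_factorSet`) holds because a homomorphism on cycles of the bar complex extends to all chains,
the boundaries being free; for injectivity (`exists_coboundary_of_chainPairing_eq`) one divides by
`n`. In terms of factor sets these are the existence and the uniqueness of the `a`-central extension.

An automorphism of `P` twists an `a`-central extension into another one, by naturality of
`H₂(P, ℤ) → H₂(P, A)`, and therefore lifts to `C` (`IsACentralExtension.exists_mulAut`). The lift is
unique as `Hom(P, M) = 0` (`GroupExtension.IsCentral.hom_ext`). Applied to conjugation by elements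
of `G`, uniqueness shows that the lifts form an action and that elements of `C` act by inner
automorphisms, which is the Peiffer identity (`IsACentralExtension.existsUnique_act`).

For a crossed module, the cocycle identity (`IsCrossedModule.isCocycle`) and the effect of a change
of choices (`IsCrossedModule.exists_coboundary`) are computations with the Peiffer identity. The
latter is stated for functions `K → G` on an arbitrary group `K` over `H`. With `K = H` it shows that
the class does not depend on the choices; if `K → H` lifts to a homomorphism `K → G`, that lift has
the trivial factor set, so the class dies in `H³(K, M)`
(`IsCharacteristicCocycle.pullback_eq_zero`). A homomorphic section is the case `K = H`. A weak
solution `Γ → G` makes `p` factor through `f`, and `K = G` shows that the class already vanishes when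
restricted along `f`.
-/

/-! ### Inhomogeneous cochains and continuous cohomology of discrete groups -/

section cohomology

section complex

variable {k : Type*} [Ring k] [TopologicalSpace k]

/-- Elements annihilated by the differential lift to the abstract object of cycles. -/
lemma TopModuleCat.exists_cycle (K : CochainComplex (TopModuleCat.{v} k) ℕ) (n : ℕ) (x : K.X n)
    (hx : (K.d n (n + 1)).hom x = 0) : ∃ z : K.cycles n, (K.iCycles n).hom z = x := by
  let i : TopModuleCat.of k (K.d n (n + 1)).hom.ker ⟶ K.X n :=
    TopModuleCat.ofHom (Submodule.subtypeL _)
  have hi : i ≫ K.d n (n + 1) = 0 := by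
    ext y
    exact y.2
  refine ⟨(K.liftCycles i (n + 1) (by simp) hi).hom ⟨x, hx⟩, ?_⟩
  exact congr(($(K.liftCycles_i i (n + 1) (by simp) hi)).hom ⟨x, hx⟩)

/-- The object of cycles is isomorphic to the kernel of the differential. -/
lemma TopModuleCat.iCycles_injective (K : CochainComplex (TopModuleCat.{v} k) ℕ) (n : ℕ) :
    Function.Injective (K.iCycles n).hom := by
  let i : TopModuleCat.of k (K.d n (n + 1)).hom.ker ⟶ K.X n :=
    TopModuleCat.ofHom (Submodule.subtypeL _)
  have hi : i ≫ K.d n (n + 1) = 0 := by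
    ext y
    exact y.2
  have h0 (z) : (K.d n (n + 1)).hom ((K.iCycles n).hom z) = 0 :=
    congr(($(K.iCycles_d n (n + 1))).hom z)
  let m : K.cycles n ⟶ TopModuleCat.of k (K.d n (n + 1)).hom.ker :=
    TopModuleCat.ofHom ((K.iCycles n).hom.codRestrict _ h0)
  have hm : m ≫ K.liftCycles i (n + 1) (by simp) hi = 𝟙 _ := by
    rw [← cancel_mono (K.iCycles n), Category.assoc, K.liftCycles_i, Category.id_comp]
    rfl
  intro z w h
  have hz : m.hom z = m.hom w := Subtype.ext h
  have e (z) : (K.liftCycles i (n + 1) (by simp) hi).hom (m.hom z) = z := congr(($hm).hom z)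
  rw [← e z, ← e w, hz]

/-- A cycle may be changed by a boundary without changing its homology class. -/
lemma TopModuleCat.exists_homologous_cycle (K : CochainComplex (TopModuleCat.{v} k) ℕ) (n : ℕ)
    (z : K.cycles (n + 1)) (y : K.X n) :
    ∃ w : K.cycles (n + 1), (K.homologyπ (n + 1)).hom w = (K.homologyπ (n + 1)).hom z ∧
      (K.iCycles (n + 1)).hom w = (K.iCycles (n + 1)).hom z + (K.d n (n + 1)).hom y := by
  refine ⟨z + (K.toCycles n (n + 1)).hom y, ?_, ?_⟩
  · rw [map_add, add_eq_left]
    exact congr(($(K.toCycles_comp_homologyπ n (n + 1))).hom y)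
  · rw [map_add]
    exact congr(_ + ($(K.toCycles_i n (n + 1))).hom y)

end complex

lemma TopRep.rho_inv_mul {K : Type v} [Group K] (X : TopRep.{v} ℤ K) (g h : K) (m : X) :
    X.ρ g (X.ρ (g⁻¹ * h) m) = X.ρ h m := by
  have := congr($(map_mul X.ρ g (g⁻¹ * h)) m)
  rw [mul_inv_cancel_left] at this
  exact this.symm

variable {K : Type v} [Group K] [TopologicalSpace K] [IsTopologicalGroup K] (X : TopRep.{v} ℤ K)

lemma IsClassOfCocycle.eq {X : TopRep.{v} ℤ K} {c : K → K → K → X} {x y : HThree X}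
    (hx : IsClassOfCocycle c x) (hy : IsClassOfCocycle c y) : x = y := by
  obtain ⟨z, rfl, hz⟩ := hx
  obtain ⟨w, rfl, hw⟩ := hy
  have : z = w := by
    apply TopModuleCat.iCycles_injective
    apply Subtype.ext
    refine ContinuousMap.ext fun a => ContinuousMap.ext fun b => ContinuousMap.ext fun c =>
      ContinuousMap.ext fun d => ?_
    exact (hz a b c d).trans (hw a b c d).symm
  rw [this]

lemma isClassOfCocycle_zero : IsClassOfCocycle (fun _ _ _ => (0 : X)) (0 : HThree X) := by
  refine ⟨0, map_zero _, fun g₀ _ _ _ => ?_⟩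
  rw [map_zero, map_zero]
  rfl

lemma TopRep.d_three_apply (y : C(K, C(K, C(K, X)))) (g₀ g₁ g₂ g₃ : K) :
    (((TopRep.d X 3).hom y : C(K, C(K, C(K, C(K, X))))) g₀ g₁ g₂ g₃) =
      y g₁ g₂ g₃ - y g₀ g₂ g₃ + y g₀ g₁ g₃ - y g₀ g₁ g₂ := by
  have : (((TopRep.d X 3).hom y : C(K, C(K, C(K, C(K, X))))) g₀ g₁ g₂ g₃) =
      y g₁ g₂ g₃ - (y g₀ g₂ g₃ - (y g₀ g₁ g₃ - y g₀ g₁ g₂)) := rfl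
  rw [this]
  abel

lemma TopRep.d_four_apply (y : C(K, C(K, C(K, C(K, X))))) (g₀ g₁ g₂ g₃ g₄ : K) :
    (((TopRep.d X 4).hom y : C(K, C(K, C(K, C(K, C(K, X)))))) g₀ g₁ g₂ g₃ g₄) =
      y g₁ g₂ g₃ g₄ - y g₀ g₂ g₃ g₄ + y g₀ g₁ g₃ g₄ - y g₀ g₁ g₂ g₄ + y g₀ g₁ g₂ g₃ := by
  have : (((TopRep.d X 4).hom y : C(K, C(K, C(K, C(K, C(K, X)))))) g₀ g₁ g₂ g₃ g₄) =
      y g₁ g₂ g₃ g₄ - (y g₀ g₂ g₃ g₄ - (y g₀ g₁ g₃ g₄ - (y g₀ g₁ g₂ g₄ - y g₀ g₁ g₂ g₃))) := rfl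
  rw [this]
  abel

lemma IsClassOfCocycle.pullback {Γ : Type v} [Group Γ] [TopologicalSpace Γ]
    [IsTopologicalGroup Γ] (p : Γ →ₜ* K) {X : TopRep.{v} ℤ K} {c : K → K → K → X} {x : HThree X}
    (hx : IsClassOfCocycle c x) :
    IsClassOfCocycle (X := TopRep.res (p : Γ →* K) X)
      (fun g h k => c (p g) (p h) (p k)) (pullback p X x) := by
  obtain ⟨z, rfl, hz⟩ := hx
  refine ⟨(ContinuousCohomology.cocyclesMap p (𝟙 (TopRep.res (p : Γ →* K) X)) 3).hom z, ?_, ?_⟩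
  · exact congr(($(ContinuousCohomology.π_map p (𝟙 (TopRep.res (p : Γ →* K) X)) 3)).hom z).symm
  · intro g₀ g₁ g₂ g₃
    have h1 := congr(($(HomologicalComplex.cyclesMap_i
      (ContinuousCohomology.cochainsMap p (𝟙 (TopRep.res (p : Γ →* K) X))) 3)).hom z)
    have h2 := congr((($h1).1 : C(Γ, C(Γ, C(Γ, C(Γ, X))))) g₀ g₁ g₂ g₃)
    refine h2.trans ((hz (p g₀) (p g₁) (p g₂) (p g₃)).trans ?_)
    simp only [← map_inv, ← map_mul]
    rfl

section discrete

variable [DiscreteTopology K]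

/-- The homogeneous `2`-cochain `(g₀, g₁, g₂) ↦ g₀ • e(g₀⁻¹g₁, g₁⁻¹g₂)` attached to an
inhomogeneous `2`-cochain `e`. -/
def homogeneousTwo (e : K → K → X) : (TopRep.homogeneousCochains X).X 2 :=
  ⟨(⟨fun g₀ => ⟨fun g₁ => ⟨fun g₂ => X.ρ g₀ (e (g₀⁻¹ * g₁) (g₁⁻¹ * g₂)),
    continuous_of_discreteTopology⟩, continuous_of_discreteTopology⟩,
    continuous_of_discreteTopology⟩ : C(K, C(K, C(K, X)))), by
    intro g
    refine ContinuousMap.ext fun g₀ => ContinuousMap.ext fun g₁ => ContinuousMap.ext fun g₂ => ?_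
    have h (a b : K) : (g⁻¹ * a)⁻¹ * (g⁻¹ * b) = a⁻¹ * b := by group
    change X.ρ g (X.ρ (g⁻¹ * g₀) (e ((g⁻¹ * g₀)⁻¹ * (g⁻¹ * g₁)) ((g⁻¹ * g₁)⁻¹ * (g⁻¹ * g₂)))) =
      X.ρ g₀ (e (g₀⁻¹ * g₁) (g₁⁻¹ * g₂))
    rw [h, h, TopRep.rho_inv_mul]⟩

/-- The homogeneous `3`-cochain `(g₀, g₁, g₂, g₃) ↦ g₀ • c(g₀⁻¹g₁, g₁⁻¹g₂, g₂⁻¹g₃)` attached to an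
inhomogeneous `3`-cochain `c`. -/
def homogeneousThree (c : K → K → K → X) : (TopRep.homogeneousCochains X).X 3 :=
  ⟨(⟨fun g₀ => ⟨fun g₁ => ⟨fun g₂ => ⟨fun g₃ => X.ρ g₀ (c (g₀⁻¹ * g₁) (g₁⁻¹ * g₂) (g₂⁻¹ * g₃)),
    continuous_of_discreteTopology⟩, continuous_of_discreteTopology⟩,
    continuous_of_discreteTopology⟩, continuous_of_discreteTopology⟩ :
      C(K, C(K, C(K, C(K, X))))), by
    intro g
    refine ContinuousMap.ext fun g₀ => ContinuousMap.ext fun g₁ => ContinuousMap.ext fun g₂ =>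
      ContinuousMap.ext fun g₃ => ?_
    have h (a b : K) : (g⁻¹ * a)⁻¹ * (g⁻¹ * b) = a⁻¹ * b := by group
    change X.ρ g (X.ρ (g⁻¹ * g₀) (c ((g⁻¹ * g₀)⁻¹ * (g⁻¹ * g₁)) ((g⁻¹ * g₁)⁻¹ * (g⁻¹ * g₂))
      ((g⁻¹ * g₂)⁻¹ * (g⁻¹ * g₃)))) = X.ρ g₀ (c (g₀⁻¹ * g₁) (g₁⁻¹ * g₂) (g₂⁻¹ * g₃))
    rw [h, h, h, TopRep.rho_inv_mul]⟩

variable {X}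

lemma exists_isClassOfCocycle (c : K → K → K → X)
    (hc : ∀ h k l m, X.ρ h (c k l m) + c h (k * l) m + c h k l = c (h * k) l m + c h k (l * m)) :
    ∃ x : HThree X, IsClassOfCocycle c x := by
  obtain ⟨z, hz⟩ := TopModuleCat.exists_cycle (TopRep.homogeneousCochains X) 3
    (homogeneousThree X c) (by
      rw [TopRep.homogeneousCochains.d_eq]
      apply Subtype.ext
      refine ContinuousMap.ext fun g₀ => ContinuousMap.ext fun g₁ => ContinuousMap.ext fun g₂ =>
        ContinuousMap.ext fun g₃ => ContinuousMap.ext fun g₄ => ?_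
      refine (TopRep.d_four_apply X (homogeneousThree X c).1 g₀ g₁ g₂ g₃ g₄).trans ?_
      change X.ρ g₁ (c (g₁⁻¹ * g₂) (g₂⁻¹ * g₃) (g₃⁻¹ * g₄)) -
        X.ρ g₀ (c (g₀⁻¹ * g₂) (g₂⁻¹ * g₃) (g₃⁻¹ * g₄)) +
        X.ρ g₀ (c (g₀⁻¹ * g₁) (g₁⁻¹ * g₃) (g₃⁻¹ * g₄)) -
        X.ρ g₀ (c (g₀⁻¹ * g₁) (g₁⁻¹ * g₂) (g₂⁻¹ * g₄)) +
        X.ρ g₀ (c (g₀⁻¹ * g₁) (g₁⁻¹ * g₂) (g₂⁻¹ * g₃)) = 0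
      have := congr(X.ρ g₀ $(hc (g₀⁻¹ * g₁) (g₁⁻¹ * g₂) (g₂⁻¹ * g₃) (g₃⁻¹ * g₄)))
      have h (a b c : K) : a⁻¹ * b * (b⁻¹ * c) = a⁻¹ * c := by group
      rw [h, h, h, map_add, map_add, map_add, TopRep.rho_inv_mul] at this
      rw [← sub_eq_zero] at this
      rw [← this]
      abel)
  exact ⟨_, z, rfl, fun _ _ _ _ => by rw [hz]; rfl⟩

lemma IsClassOfCocycle.of_coboundary {c c' : K → K → K → X} {x : HThree X}
    (hx : IsClassOfCocycle c x) (e : K → K → X)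
    (h : ∀ h k l, c' h k l + e h k + e (h * k) l = c h k l + X.ρ h (e k l) + e h (k * l)) :
    IsClassOfCocycle c' x := by
  obtain ⟨z, rfl, hz⟩ := hx
  obtain ⟨w, hw, hw'⟩ := TopModuleCat.exists_homologous_cycle (TopRep.homogeneousCochains X) 2 z
    (homogeneousTwo X e)
  refine ⟨w, hw, fun g₀ g₁ g₂ g₃ => ?_⟩
  rw [TopRep.homogeneousCochains.d_eq] at hw'
  have h1 := congr((($hw').1 : C(K, C(K, C(K, C(K, X))))) g₀ g₁ g₂ g₃)
  have h2 := TopRep.d_three_apply X (homogeneousTwo X e).1 g₀ g₁ g₂ g₃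
  refine h1.trans ((congr($(hz g₀ g₁ g₂ g₃) + $h2)).trans ?_)
  change X.ρ g₀ (c (g₀⁻¹ * g₁) (g₁⁻¹ * g₂) (g₂⁻¹ * g₃)) +
    (X.ρ g₁ (e (g₁⁻¹ * g₂) (g₂⁻¹ * g₃)) - X.ρ g₀ (e (g₀⁻¹ * g₂) (g₂⁻¹ * g₃)) +
      X.ρ g₀ (e (g₀⁻¹ * g₁) (g₁⁻¹ * g₃)) - X.ρ g₀ (e (g₀⁻¹ * g₁) (g₁⁻¹ * g₂))) =
    X.ρ g₀ (c' (g₀⁻¹ * g₁) (g₁⁻¹ * g₂) (g₂⁻¹ * g₃))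
  have h3 := congr(X.ρ g₀ $(h (g₀⁻¹ * g₁) (g₁⁻¹ * g₂) (g₂⁻¹ * g₃)))
  have h4 (a b c : K) : a⁻¹ * b * (b⁻¹ * c) = a⁻¹ * c := by group
  rw [h4, h4, map_add, map_add, map_add, map_add, TopRep.rho_inv_mul, ← sub_eq_zero] at h3
  rw [← sub_eq_zero, ← neg_eq_zero, ← h3]
  abel

end discrete

end cohomology

/-! ### The characteristic cocycle of a crossed module -/

section crossedModule

variable {C G M K : Type*} [Group C] [Group G] [AddCommGroup M] [Group K]
  {ι : Multiplicative M →* C} {d : C →* G} {act : G →* MulAut C} {ρ : K → M → M}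
  {s : K → G} {F : K → K → C} {c : K → K → K → M}

lemma IsCrossedModule.act_act (hd : IsCrossedModule d act)
    (hF : ∀ h k, s h * s k = d (F h k) * s (h * k)) (h k : K) (x : C) :
    act (s h) (act (s k) x) = F h k * act (s (h * k)) x * (F h k)⁻¹ := by
  rw [← MulAut.mul_apply, ← map_mul, hF, map_mul, MulAut.mul_apply, hd.peiffer]

/-- Comparing the two ways of expanding `ˢ⁽ʰ⁾(ˢ⁽ᵏ⁾F(l, m))` shows that a characteristic cochain
is a `3`-cocycle. -/
lemma IsCrossedModule.isCocycle (hd : IsCrossedModule d act)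
    (hι : Function.Injective ι) (hcen : ι.range ≤ Subgroup.center C)
    (hρ : ∀ h m, act (s h) (ι (Multiplicative.ofAdd m)) = ι (Multiplicative.ofAdd (ρ h m)))
    (hF : ∀ h k, s h * s k = d (F h k) * s (h * k))
    (hc : ∀ h k l, act (s h) (F k l) * F h (k * l) =
      ι (Multiplicative.ofAdd (c h k l)) * F h k * F (h * k) l) (h k l m : K) :
    ρ h (c k l m) + c h (k * l) m + c h k l = c (h * k) l m + c h k (l * m) := by
  have hz' (x : C) (n : Multiplicative M) : x * ι n = ι n * x :=
    Subgroup.mem_center_iff.1 (hcen ⟨n, rfl⟩) x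
  have hz (x : C) (n : Multiplicative M) (y : C) : x * (ι n * y) = ι n * (x * y) := by
    rw [← mul_assoc, hz', mul_assoc]
  have hc' (h k l : K) : act (s h) (F k l) =
      ι (Multiplicative.ofAdd (c h k l)) * F h k * F (h * k) l * (F h (k * l))⁻¹ :=
    eq_mul_inv_of_mul_eq (hc h k l)
  -- expand the left side by the formula for `F(k, l)`, and the right side by that for `F(hk, l)`
  have key := hd.act_act hF h k (F l m)
  rw [hc' k l m] at key
  simp only [map_mul, map_inv, hρ, hc'] at key
  simp only [mul_inv_rev, mul_assoc, inv_inv, inv_mul_cancel_left, hz (F _ _), hz (F _ _)⁻¹,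
    hz' (F _ _)⁻¹, ← map_inv, ← ofAdd_neg] at key
  simp only [← mul_assoc, ← map_mul, ← ofAdd_add, mul_left_inj] at key
  have := congrArg (· + c h k (l * m)) (Multiplicative.ofAdd.injective (hι key))
  rw [← this]
  abel

/-- The change of the characteristic cocycle under a change of choices. If `s'(k) = d(b(k)) s(k)`,
then `F'(h, k)` and `b(h) ˢ⁽ʰ⁾b(k) F(h, k) b(hk)⁻¹` differ by a central `2`-cochain `e`, and
the two cocycles differ by the coboundary of `e`. -/
lemma IsCrossedModule.exists_coboundary (hd : IsCrossedModule d act)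
    (hι : Function.Injective ι) (hcen : ι.range ≤ Subgroup.center C) (hker : d.ker ≤ ι.range)
    (hρ : ∀ h m, act (s h) (ι (Multiplicative.ofAdd m)) = ι (Multiplicative.ofAdd (ρ h m)))
    (hF : ∀ h k, s h * s k = d (F h k) * s (h * k))
    (hc : ∀ h k l, act (s h) (F k l) * F h (k * l) =
      ι (Multiplicative.ofAdd (c h k l)) * F h k * F (h * k) l)
    {s' : K → G} {F' : K → K → C} {c' : K → K → K → M}
    (hF' : ∀ h k, s' h * s' k = d (F' h k) * s' (h * k))
    (hc' : ∀ h k l, act (s' h) (F' k l) * F' h (k * l) =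
      ι (Multiplicative.ofAdd (c' h k l)) * F' h k * F' (h * k) l)
    (hs : ∀ k, ∃ b, s' k = d b * s k) :
    ∃ e : K → K → M, ∀ h k l,
      c' h k l + e h k + e (h * k) l = c h k l + ρ h (e k l) + e h (k * l) := by
  choose b hb using hs
  have he (h k : K) : ∃ e : M, F' h k =
      ι (Multiplicative.ofAdd e) * (b h * act (s h) (b k) * F h k * (b (h * k))⁻¹) := by
    obtain ⟨e, he⟩ := hker (x := F' h k * (b h * act (s h) (b k) * F h k * (b (h * k))⁻¹)⁻¹) (by
      have h1 := eq_mul_inv_of_mul_eq (hF' h k).symm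
      have h2 := eq_mul_inv_of_mul_eq (hF h k).symm
      rw [MonoidHom.mem_ker, map_mul, map_inv, mul_inv_eq_one, map_mul, map_mul, map_mul, map_inv,
        hd.equivariant, h1, h2, hb, hb, hb]
      group)
    exact ⟨Multiplicative.toAdd e, mul_inv_eq_iff_eq_mul.1 he.symm⟩
  choose e he using he
  refine ⟨e, fun h k l => ?_⟩
  have hz' (x : C) (n : Multiplicative M) : x * ι n = ι n * x :=
    Subgroup.mem_center_iff.1 (hcen ⟨n, rfl⟩) x
  have hz (x : C) (n : Multiplicative M) (y : C) : x * (ι n * y) = ι n * (x * y) := by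
    rw [← mul_assoc, hz', mul_assoc]
  have hc'' (h k l : K) : act (s h) (F k l) =
      ι (Multiplicative.ofAdd (c h k l)) * F h k * F (h * k) l * (F h (k * l))⁻¹ :=
    eq_mul_inv_of_mul_eq (hc h k l)
  have key := hc' h k l
  have hact (x : C) : act (s' h) x = b h * act (s h) x * (b h)⁻¹ := by
    rw [hb, map_mul, MulAut.mul_apply, hd.peiffer]
  rw [hact] at key
  simp only [he, map_mul, map_inv, hd.act_act hF, hρ, hc''] at key
  simp only [mul_assoc, inv_mul_cancel_left, hz (F _ _), hz (F _ _)⁻¹, hz (b _), hz (b _)⁻¹,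
    hz (act _ _), hz (act _ _)⁻¹] at key
  simp only [← mul_assoc, ← map_mul, ← ofAdd_add, mul_left_inj] at key
  have := Multiplicative.ofAdd.injective (hι key)
  rw [add_assoc, ← this]
  abel

end crossedModule

/-! ### Coprimality of `Pᵃᵇ` and `A` -/

section coprime

/-- Finite modules whose tensor product vanishes have disjoint supports, so their annihilators are
comaximal. -/
lemma Module.exists_smul_eq_zero_and_smul_eq_self (R B A : Type*) [CommRing R] [AddCommGroup B]
    [AddCommGroup A] [Module R B] [Module R A] [Module.Finite R B] [Module.Finite R A]
    [Subsingleton (B ⊗[R] A)] : ∃ r : R, (∀ b : B, r • b = 0) ∧ ∀ a : A, r • a = a := by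
  by_cases h : Module.annihilator R B ⊔ Module.annihilator R A = ⊤
  · obtain ⟨r, hr, t, ht, hrt⟩ := Submodule.mem_sup.1 ((Ideal.eq_top_iff_one _).1 h)
    refine ⟨r, fun b => Module.mem_annihilator.1 hr b, fun a => ?_⟩
    rw [← add_zero (r • a), ← Module.mem_annihilator.1 ht a, ← add_smul, hrt, one_smul]
  · exfalso
    obtain ⟨m, hm, hle⟩ := Ideal.exists_le_maximal _ h
    let p : PrimeSpectrum R := ⟨m, hm.isPrime⟩
    let κ := p.asIdeal.ResidueField
    have hB : Nontrivial (κ ⊗[R] B) :=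
      (Module.mem_support_iff_nontrivial_residueField_tensorProduct p).1
        (Module.mem_support_iff_of_finite.2 (le_sup_left.trans hle))
    have hA : Nontrivial (κ ⊗[R] A) :=
      (Module.mem_support_iff_nontrivial_residueField_tensorProduct p).1
        (Module.mem_support_iff_of_finite.2 (le_sup_right.trans hle))
    have e := TensorProduct.AlgebraTensorModule.distribBaseChange R κ B A
    have : Nontrivial ((κ ⊗[R] B) ⊗[κ] (κ ⊗[R] A)) := inferInstance
    have := e.toEquiv.nontrivial
    exact not_subsingleton (κ ⊗[R] (B ⊗[R] A)) inferInstance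

end coprime

section perfect

variable {P A : Type} [Group P] [AddCommGroup A]

/-- The arithmetic content of `A`-perfectness: some integer annihilates `Pᵃᵇ` and acts as the
identity on `A`, hence on `H₂(P, A)`. It makes `Hom(P, H₂(P, A))` and `Ext(Pᵃᵇ, H₂(P, A))` vanish. -/
lemma IsAPerfect.exists_int [Finite P] [AddGroup.FG A] (h : IsAPerfect P A) :
    ∃ n : ℤ, (∀ g : P, Abelianization.of g ^ n = 1) ∧ ∀ a : A, n • a = a := by
  have : Subsingleton (Additive (Abelianization P) ⊗[ℤ] A) := h
  have : Finite (Abelianization P) := Finite.of_surjective _ (QuotientGroup.mk_surjective)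
  have : Module.Finite ℤ A := Module.Finite.iff_addGroup_fg.2 inferInstance
  obtain ⟨n, h1, h2⟩ := Module.exists_smul_eq_zero_and_smul_eq_self ℤ
    (Additive (Abelianization P)) A
  exact ⟨n, fun g => h1 (Additive.ofMul (Abelianization.of g)), h2⟩

namespace HTwo

variable {B : Type} [AddCommGroup B]

lemma zsmul_eq_self {n : ℤ} (hn : ∀ a : A, n • a = a) (x : HTwo P A) : n • x = x := by
  obtain ⟨x, rfl⟩ := mk_surjective x
  have : n • x = x := by
    apply Subtype.ext
    ext g
    exact hn _
  change n • (groupHomology.H2π (Rep.trivial ℤ P A)).hom x = (groupHomology.H2π _).hom x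
  rw [← map_zsmul, this]

lemma map_mk {Q : Type} [Group Q] (φ : P →* Q) (s : A →+ B)
    (x : groupHomology.cycles₂ (Rep.trivial ℤ P A)) :
    map φ s (mk x) = mk ((groupHomology.mapCycles₂ (A := Rep.trivial ℤ P A)
      (B := Rep.trivial ℤ Q B) φ (Rep.ofHom ⟨s.toIntLinearMap, fun _ => rfl⟩)).hom x) :=
  congr(($(groupHomology.H2π_comp_map (A := Rep.trivial ℤ P A)
    (B := Rep.trivial ℤ Q B) φ
    (Rep.ofHom ⟨s.toIntLinearMap, fun _ => rfl⟩))).hom x)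

end HTwo

end perfect

/-! ### Factor sets and the universal coefficient theorem -/

section factorSet

variable {P : Type} [Group P] {M : Type*} [AddCommGroup M]

/-- The boundary `ℤ[P × P] → ℤ[P]` of the bar complex. -/
noncomputable def barBoundary (P : Type) [Group P] : (P × P →₀ ℤ) →ₗ[ℤ] (P →₀ ℤ) :=
  (groupHomology.d₂₁ (Rep.trivial ℤ P ℤ)).hom

lemma barBoundary_single (g h : P) (n : ℤ) : barBoundary P (Finsupp.single (g, h) n) =
    Finsupp.single h n - Finsupp.single (g * h) n + Finsupp.single g n :=
  groupHomology.d₂₁_single (A := Rep.trivial ℤ P ℤ) (g, h) n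

/-- The linear extension `∑ nᵢ [gᵢ|hᵢ] ↦ ∑ nᵢ z(gᵢ, hᵢ)` of a `2`-cochain `z`. -/
noncomputable def chainPairing (z : P → P → M) : (P × P →₀ ℤ) →ₗ[ℤ] M :=
  Finsupp.linearCombination ℤ fun gh => z gh.1 gh.2

lemma chainPairing_apply {P : Type} (z : P → P → M) (x : P × P →₀ ℤ) :
    chainPairing z x = x.sum fun gh n => n • z gh.1 gh.2 :=
  Finsupp.linearCombination_apply _ _

lemma chainPairing_single {P : Type} (z : P → P → M) (g h : P) (n : ℤ) :
    chainPairing z (Finsupp.single (g, h) n) = n • z g h :=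
  Finsupp.linearCombination_single _ _ _

/-- Cohomologous factor sets agree on cycles. -/
lemma chainPairing_eq_of_coboundary {z z' : P → P → M} (b : P → M)
    (h : ∀ g h, z' g h + b (g * h) = b g + b h + z g h) {x : P × P →₀ ℤ}
    (hx : barBoundary P x = 0) : chainPairing z' x = chainPairing z x := by
  have key : chainPairing z' = chainPairing z + Finsupp.linearCombination ℤ b ∘ₗ barBoundary P := by
    refine Finsupp.lhom_ext fun gh n => ?_
    obtain ⟨g, k⟩ := gh
    rw [LinearMap.add_apply, LinearMap.comp_apply, barBoundary_single, map_add, map_sub]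
    simp only [chainPairing_single, Finsupp.linearCombination_single]
    rw [eq_sub_of_add_eq (h g k)]
    simp only [smul_sub, smul_add]
    abel
  rw [key, LinearMap.add_apply, LinearMap.comp_apply, hx, map_zero, add_zero]

/-- Surjectivity of `H²(P, M) → Hom(H₂(P, ℤ), M)`: since the module of boundaries is free, a
homomorphism on cycles extends to all chains. -/
lemma exists_factorSet [Finite P] (δ : HTwo P ℤ →+ M) :
    ∃ z : P → P → M, (∀ g h k, z h k + z g (h * k) = z g h + z (g * h) k) ∧
      ∀ x : groupHomology.cycles₂ (Rep.trivial ℤ P ℤ), δ (HTwo.mk x) = chainPairing z x.1 := by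
  obtain ⟨σ, hσ⟩ := Module.projective_lifting_property (barBoundary P).rangeRestrict
    LinearMap.id (barBoundary P).surjective_rangeRestrict
  have hσ' (y) : barBoundary P (σ y) = y := congr(($hσ y).1)
  -- the projection of the chains onto the cycles
  let r : (P × P →₀ ℤ) →ₗ[ℤ] (P × P →₀ ℤ) :=
    LinearMap.id - σ ∘ₗ (barBoundary P).rangeRestrict
  have hr (x) : barBoundary P (r x) = 0 := by
    change barBoundary P (x - σ _) = 0
    rw [map_sub, hσ', sub_eq_zero]
    rfl
  let φ : (P × P →₀ ℤ) →ₗ[ℤ] M := (δ.comp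
    ((groupHomology.H2π (Rep.trivial ℤ P ℤ)).hom.toAddMonoidHom.comp
      (r.codRestrict (groupHomology.cycles₂ (Rep.trivial ℤ P ℤ)) hr).toAddMonoidHom)).toIntLinearMap
  have hφ (x : groupHomology.cycles₂ (Rep.trivial ℤ P ℤ)) : φ x.1 = δ (HTwo.mk x) := by
    change δ (HTwo.mk _) = _
    congr 2
    apply Subtype.ext
    change x.1 - σ ((barBoundary P).rangeRestrict x.1) = x.1
    have : (barBoundary P).rangeRestrict x.1 = 0 := Subtype.ext x.2
    rw [this, map_zero, sub_zero]
  have hz : chainPairing (fun g h => φ (Finsupp.single (g, h) 1)) = φ := by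
    ext gh
    simp [chainPairing]
  refine ⟨fun g h => φ (Finsupp.single (g, h) 1), fun g h k => ?_, fun x => ?_⟩
  -- the cocycle identity says that `φ` vanishes on the boundary of `[g|h|k]`
  · have hmem : (groupHomology.d₃₂ (Rep.trivial ℤ P ℤ)).hom (Finsupp.single (g, h, k) (1 : ℤ)) ∈
        groupHomology.cycles₂ (Rep.trivial ℤ P ℤ) :=
      groupHomology.boundaries₂_le_cycles₂ _ ⟨_, rfl⟩
    have h0 : HTwo.mk ⟨_, hmem⟩ = 0 :=
      (groupHomology.H2π_eq_zero_iff (A := Rep.trivial ℤ P ℤ) _).2 ⟨_, rfl⟩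
    have h1 := hφ ⟨_, hmem⟩
    have h2 : (groupHomology.d₃₂ (Rep.trivial ℤ P ℤ)).hom (Finsupp.single (g, h, k) (1 : ℤ)) =
        Finsupp.single (h, k) (1 : ℤ) - Finsupp.single (g * h, k) 1
          + Finsupp.single (g, h * k) 1 - Finsupp.single (g, h) 1 :=
      groupHomology.d₃₂_single (A := Rep.trivial ℤ P ℤ) (g, h, k) (1 : ℤ)
    rw [h0, map_zero] at h1
    have h3 := congr(φ $h2).symm.trans h1
    rw [map_sub, map_add, map_sub] at h3
    rw [← sub_eq_zero, ← h3]
    abel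
  · rw [hz, hφ]

/-- Injectivity of `H²(P, M) → Hom(H₂(P, ℤ), M)` in case `Ext(Pᵃᵇ, M)` vanishes because some
integer annihilates `Pᵃᵇ` and acts as the identity on `M`. -/
lemma exists_coboundary_of_chainPairing_eq {n : ℤ} (hn : ∀ g : P, Abelianization.of g ^ n = 1)
    (hM : ∀ m : M, n • m = m) {z z' : P → P → M}
    (h : ∀ x, barBoundary P x = 0 → chainPairing z' x = chainPairing z x) :
    ∃ b : P → M, ∀ g h, z' g h + b (g * h) = b g + b h + z g h := by
  -- the boundary relations make `g ↦ [g]` a homomorphism to the quotient by boundaries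
  let θ : P →* Multiplicative ((P →₀ ℤ) ⧸ (barBoundary P).range) :=
    { toFun g := Multiplicative.ofAdd (Submodule.Quotient.mk (Finsupp.single g 1))
      map_one' := by
        refine (Submodule.Quotient.mk_eq_zero _).2 ⟨Finsupp.single (1, 1) 1, ?_⟩
        rw [barBoundary_single]
        simp
      map_mul' g h := by
        rw [← ofAdd_add, ← Submodule.Quotient.mk_add]
        refine congrArg _ ((Submodule.Quotient.eq _).2 ⟨-Finsupp.single (g, h) 1, ?_⟩)
        rw [map_neg, barBoundary_single]
        abel }
  have hθ (g : P) : ∃ y, barBoundary P y = n • Finsupp.single g (1 : ℤ) := by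
    have h1 : θ g ^ n = 1 := by
      have := congr(Abelianization.lift θ $(hn g))
      rwa [map_zpow, map_one, Abelianization.lift_apply_of] at this
    exact (Submodule.Quotient.mk_eq_zero _).1 h1
  choose y hy using hθ
  -- `ψ = z' - z` vanishes on cycles, so `ψ(y)` depends only on the boundary of `y`; as `n` acts as
  -- the identity on `M`, the value of `ψ` at a chain `y` with boundary `n[g]` does for `[g]`.
  refine ⟨fun g => (chainPairing z' - chainPairing z) (y g), fun g k => ?_⟩
  have h1 : (chainPairing z' - chainPairing z)
      (n • Finsupp.single (g, k) 1 - (y k - y (g * k) + y g)) = 0 := by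
    rw [LinearMap.sub_apply, sub_eq_zero]
    apply h
    rw [map_sub, map_zsmul, barBoundary_single, map_add, map_sub, hy, hy, hy, smul_add, smul_sub,
      sub_self]
  rw [map_sub, sub_eq_zero, map_zsmul, hM, map_add, map_sub, LinearMap.sub_apply,
    chainPairing_single, chainPairing_single, one_smul, one_smul] at h1
  rw [eq_add_of_sub_eq h1]
  abel

end factorSet

/-! ### Central extensions -/

section centralExtension

variable {P : Type} [Group P] {M : Type*} [AddCommGroup M]

/-- The set underlying the central extension of `P` by `M` with factor set `z`. -/
@[ext]
structure TwistedProduct (z : P → P → M) where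
  /-- The component in `M`. -/
  fiber : M
  /-- The component in `P`. -/
  base : P

lemma TwistedProduct.factorSet_one_left {z : P → P → M}
    (hz : ∀ g h k, z h k + z g (h * k) = z g h + z (g * h) k) (g : P) : z 1 g = z 1 1 := by
  simpa using hz 1 1 g

/-- The group structure `(m, g)(n, h) = (m + n + z(g, h), gh)`. As `z` need not be normalized, the
identity is `(-z(1, 1), 1)`. -/
abbrev TwistedProduct.group (z : P → P → M)
    (hz : ∀ g h k, z h k + z g (h * k) = z g h + z (g * h) k) : Group (TwistedProduct z) :=
  letI : Mul (TwistedProduct z) := ⟨fun x y => ⟨x.1 + y.1 + z x.2 y.2, x.2 * y.2⟩⟩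
  letI : One (TwistedProduct z) := ⟨⟨-z 1 1, 1⟩⟩
  letI : Inv (TwistedProduct z) := ⟨fun x => ⟨-x.1 - z x.2⁻¹ x.2 - z 1 1, x.2⁻¹⟩⟩
  Group.ofLeftAxioms
    (fun x y w => TwistedProduct.ext (by
      change x.1 + y.1 + z x.2 y.2 + w.1 + z (x.2 * y.2) w.2 =
        x.1 + (y.1 + w.1 + z y.2 w.2) + z x.2 (y.2 * w.2)
      have := hz x.2 y.2 w.2
      rw [← sub_eq_zero] at this ⊢
      rw [← neg_eq_zero, ← this]
      abel) (mul_assoc _ _ _))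
    (fun x => TwistedProduct.ext (by
      change -z 1 1 + x.1 + z 1 x.2 = x.1
      rw [factorSet_one_left hz x.2, add_right_comm, neg_add_cancel, zero_add]) (one_mul _))
    (fun x => TwistedProduct.ext (by
      change -x.1 - z x.2⁻¹ x.2 - z 1 1 + x.1 + z x.2⁻¹ x.2 = - z 1 1
      abel) (inv_mul_cancel _))

/-- The central extension of `P` by `M` with factor set `z`. -/
def TwistedProduct.extension (z : P → P → M)
    (hz : ∀ g h k, z h k + z g (h * k) = z g h + z (g * h) k) :
    letI := TwistedProduct.group z hz
    GroupExtension (Multiplicative M) (TwistedProduct z) P :=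
  letI := TwistedProduct.group z hz
  { inl :=
      { toFun m := ⟨m.toAdd - z 1 1, 1⟩
        map_one' := TwistedProduct.ext (zero_sub _) rfl
        map_mul' m n := TwistedProduct.ext (by
          change m.toAdd + n.toAdd - z 1 1 = m.toAdd - z 1 1 + (n.toAdd - z 1 1) + z 1 1
          abel) (mul_one 1).symm }
    rightHom :=
      { toFun x := x.2
        map_one' := rfl
        map_mul' _ _ := rfl }
    inl_injective m n h := Multiplicative.toAdd.injective
      (sub_left_injective (congrArg TwistedProduct.fiber h))
    range_inl_eq_ker_rightHom := by
      ext x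
      constructor
      · rintro ⟨m, rfl⟩
        rfl
      · intro hx
        exact ⟨Multiplicative.ofAdd (x.1 + z 1 1), TwistedProduct.ext
          (add_sub_cancel_right _ _) (Eq.symm hx)⟩
    rightHom_surjective g := ⟨⟨0, g⟩, rfl⟩ }

namespace GroupExtension

variable {C : Type*} [Group C] (E : GroupExtension (Multiplicative M) C P)

/-- Every section has a factor set. -/
lemma Section.exists_factorSet {E : GroupExtension (Multiplicative M) C P} (σ : E.Section) :
    ∃ z : P → P → M, ∀ g h, σ g * σ h = E.inl (Multiplicative.ofAdd (z g h)) * σ (g * h) := by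
  choose z hz using σ.mul_mul_mul_inv_mem_range_inl
  exact ⟨fun g h => (z g h).toAdd, fun g h => mul_inv_eq_iff_eq_mul.1 (hz g h).symm⟩

variable {E}

lemma IsCentral.commute (hE : E.IsCentral) (x : C) (m : Multiplicative M) :
    x * E.inl m = E.inl m * x :=
  Subgroup.mem_center_iff.1 (hE ⟨m, rfl⟩) x

lemma IsCentral.inl_mul_mul (hE : E.IsCentral) (m n : Multiplicative M) (x y : C) :
    E.inl m * x * (E.inl n * y) = E.inl (m * n) * (x * y) := by
  rw [mul_assoc, ← mul_assoc x, hE.commute, map_mul, mul_assoc, mul_assoc]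

/-- The condition on factor sets need only be checked for one section. -/
lemma IsCentral.isUniversalCoefficientImage (hE : E.IsCentral) {δ : HTwo P ℤ →+ M}
    (σ : P → C) (hσ : ∀ g, E.rightHom (σ g) = g) (z : P → P → M)
    (hz : ∀ g h, σ g * σ h = E.inl (Multiplicative.ofAdd (z g h)) * σ (g * h))
    (hδ : ∀ x : groupHomology.cycles₂ (Rep.trivial ℤ P ℤ), δ (HTwo.mk x) = chainPairing z x.1) :
    E.IsUniversalCoefficientImage δ := by
  intro σ' z' hz' x
  have hb (g : P) : ∃ b : M, σ' g = E.inl (Multiplicative.ofAdd b) * σ g := by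
    obtain ⟨n, hn⟩ := σ'.exists_eq_inl_mul (⟨σ, hσ⟩ : E.Section) g
    exact ⟨n.toAdd, hn⟩
  choose b hb using hb
  rw [hδ]
  refine (chainPairing_eq_of_coboundary b (fun g h => ?_) x.2).symm.trans
    (chainPairing_apply z' x.1)
  have h1 := hz' g h
  rw [hb, hb, hb, hE.inl_mul_mul, hz, ← mul_assoc, ← mul_assoc, ← map_mul E.inl, ← map_mul E.inl,
    mul_left_inj] at h1
  exact (Multiplicative.ofAdd.injective (E.inl_injective h1)).symm

/-- Central extensions with cohomologous factor sets are equivalent. -/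
lemma IsCentral.nonempty_equiv {C' : Type*} [Group C']
    {E' : GroupExtension (Multiplicative M) C' P} (hE : E.IsCentral) (hE' : E'.IsCentral)
    (σ : E.Section) (σ' : E'.Section) (z z' : P → P → M)
    (hz : ∀ g h, σ g * σ h = E.inl (Multiplicative.ofAdd (z g h)) * σ (g * h))
    (hz' : ∀ g h, σ' g * σ' h = E'.inl (Multiplicative.ofAdd (z' g h)) * σ' (g * h))
    (b : P → M) (hb : ∀ g h, z' g h + b (g * h) = b g + b h + z g h) :
    Nonempty (E.Equiv E') := by
  have hm (c : C) : ∃ m : M, c = E.inl (Multiplicative.ofAdd m) * σ (E.rightHom c) := by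
    have : c * (σ (E.rightHom c))⁻¹ ∈ E.inl.range := by
      rw [E.range_inl_eq_ker_rightHom, MonoidHom.mem_ker, map_mul, map_inv, σ.rightHom_section,
        mul_inv_cancel]
    obtain ⟨m, hm⟩ := this
    exact ⟨m.toAdd, mul_inv_eq_iff_eq_mul.1 hm.symm⟩
  choose m hm using hm
  -- the decomposition `c = m(c) σ(π c)` is unique, so `m` is additive up to the factor set
  have hm1 (c : C) (n : M) (g : P) (h : c = E.inl (Multiplicative.ofAdd n) * σ g) :
      m c = n ∧ E.rightHom c = g := by
    have hg : E.rightHom c = g := by rw [h, map_mul, rightHom_inl, one_mul, σ.rightHom_section]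
    have := hm c
    rw [hg, h, mul_left_inj, ← h] at this
    exact ⟨(Multiplicative.ofAdd.injective (E.inl_injective this)).symm, hg⟩
  have hmul (c c' : C) : m (c * c') = m c + m c' + z (E.rightHom c) (E.rightHom c') := by
    refine (hm1 (c * c') _ (E.rightHom c * E.rightHom c') ?_).1
    conv_lhs => rw [hm c, hm c']
    rw [hE.inl_mul_mul, hz, ← mul_assoc, ← map_mul]
    rfl
  -- since `z'` is `z` plus the coboundary of `b`, the correction by `b` makes this multiplicative
  refine ⟨Equiv.ofMonoidHom (MonoidHom.mk' (fun c =>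
    E'.inl (Multiplicative.ofAdd (m c - b (E.rightHom c))) * σ' (E.rightHom c)) ?_) ?_ ?_⟩
  · intro c c'
    rw [hE'.inl_mul_mul, hz', ← mul_assoc, ← map_mul E'.inl, hmul, map_mul E.rightHom]
    congr 2
    refine Multiplicative.toAdd.injective ?_
    change m c + m c' + z (E.rightHom c) (E.rightHom c') - b (E.rightHom c * E.rightHom c') =
      m c - b (E.rightHom c) + (m c' - b (E.rightHom c')) + z' (E.rightHom c) (E.rightHom c')
    rw [eq_sub_of_add_eq (hb (E.rightHom c) (E.rightHom c'))]
    abel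
  · have h1 : σ 1 = E.inl (Multiplicative.ofAdd (z 1 1)) := by
      simpa using hz 1 1
    have h2 : σ' 1 = E'.inl (Multiplicative.ofAdd (z' 1 1)) := by
      simpa using hz' 1 1
    refine MonoidHom.ext fun n => ?_
    have h3 := (hm1 (E.inl n) (n.toAdd - z 1 1) 1 (by
      rw [h1, ← map_mul, ← ofAdd_add, sub_add_cancel, ofAdd_toAdd])).1
    have h4 := hb 1 1
    rw [mul_one, add_right_comm, add_left_inj] at h4
    simp only [MonoidHom.comp_apply, MonoidHom.mk'_apply, rightHom_inl]
    rw [h2, h3, h4, ← map_mul, ← ofAdd_add]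
    congr 1
    refine Multiplicative.toAdd.injective ?_
    change n.toAdd - z 1 1 - b 1 + (b 1 + z 1 1) = n.toAdd
    abel
  · ext c
    simp

end GroupExtension

end centralExtension

/-! ### The `a`-central extension and its automorphisms -/

section aCentral

variable {P A : Type} [Group P] [AddCommGroup A]

/-- Every homomorphism `P → M` is trivial when some integer annihilates `Pᵃᵇ` and acts as the
identity on `M`. -/
lemma MonoidHom.eq_one_of_zsmul_eq_self {M : Type*} [AddCommGroup M] {n : ℤ}
    (hn : ∀ g : P, Abelianization.of g ^ n = 1) (hM : ∀ m : M, n • m = m)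
    (φ : P →* Multiplicative M) (g : P) : φ g = 1 := by
  have := congr(Abelianization.lift φ $(hn g))
  rw [map_zpow, map_one, Abelianization.lift_apply_of] at this
  rw [← this]
  exact (hM (φ g).toAdd).symm

/-- Two endomorphisms of a central extension that agree on the kernel and on the quotient differ by
a homomorphism `P → M`. -/
lemma GroupExtension.IsCentral.hom_ext {M : Type*} [AddCommGroup M] {C : Type*} [Group C]
    {E : GroupExtension (Multiplicative M) C P} (hE : E.IsCentral) {n : ℤ}
    (hn : ∀ g : P, Abelianization.of g ^ n = 1) (hM : ∀ m : M, n • m = m) {α β : C →* C}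
    (hl : ∀ m, α (E.inl m) = β (E.inl m)) (hr : ∀ c, E.rightHom (α c) = E.rightHom (β c)) :
    α = β := by
  have h (c : C) : ∃ m : Multiplicative M, α c = E.inl m * β c := by
    have : α c * (β c)⁻¹ ∈ E.inl.range := by
      rw [E.range_inl_eq_ker_rightHom, MonoidHom.mem_ker, map_mul, map_inv, hr, mul_inv_cancel]
    obtain ⟨m, hm⟩ := this
    exact ⟨m, mul_inv_eq_iff_eq_mul.1 hm.symm⟩
  choose m hm using h
  let θ : C →* Multiplicative M := MonoidHom.mk' m fun c c' => by
    have := hm (c * c')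
    rw [map_mul, map_mul, hm, hm, hE.inl_mul_mul, mul_left_inj] at this
    exact (E.inl_injective this).symm
  have hθ : E.rightHom.ker ≤ θ.ker := by
    rw [← E.range_inl_eq_ker_rightHom]
    rintro _ ⟨n, rfl⟩
    have := hm (E.inl n)
    rw [hl, right_eq_mul] at this
    exact E.inl_injective (this.trans (map_one _).symm)
  ext c
  have h1 : θ c = 1 := by
    rw [← MonoidHom.liftOfRightInverse_comp_apply E.rightHom _
      (Function.rightInverse_surjInv E.rightHom_surjective) ⟨θ, hθ⟩ c]
    exact MonoidHom.eq_one_of_zsmul_eq_self hn hM _ _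
  have h2 : m c = 1 := h1
  rw [hm, h2, map_one, one_mul]

/-- The extension attached to a factor set that represents the map induced by `a`. -/
lemma exists_isACentralExtension [Finite P] (a : A) :
    ∃ (C : Type) (_ : Group C) (E : GroupExtension (Multiplicative (HTwo P A)) C P),
      IsACentralExtension a E := by
  obtain ⟨z, hz, hδ⟩ := exists_factorSet (HTwo.map (MonoidHom.id P) (zmultiplesHom A a))
  let _ := TwistedProduct.group z hz
  have hE : (TwistedProduct.extension z hz).IsCentral := by
    rintro _ ⟨m, rfl⟩
    refine Subgroup.mem_center_iff.2 fun x => TwistedProduct.ext ?_ ?_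
    · change x.1 + (m.toAdd - z 1 1) + z x.2 1 = m.toAdd - z 1 1 + x.1 + z 1 x.2
      have h1 : z x.2 1 = z 1 1 := by simpa using (hz x.2 1 1).symm
      rw [h1, TwistedProduct.factorSet_one_left hz x.2]
      abel
    · exact (mul_one x.2).trans (one_mul x.2).symm
  refine ⟨TwistedProduct z, _, TwistedProduct.extension z hz, hE,
    hE.isUniversalCoefficientImage (fun g => ⟨0, g⟩) (fun g => rfl) z (fun g h => ?_) hδ⟩
  refine TwistedProduct.ext ?_ (one_mul _).symm
  change 0 + 0 + z g h = z g h - z 1 1 + 0 + z 1 (g * h)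
  rw [TwistedProduct.factorSet_one_left hz (g * h)]
  abel

lemma IsACentralExtension.nonempty_equiv [Finite P] [AddGroup.FG A] (hP : IsAPerfect P A) {a : A}
    {C C' : Type*} [Group C] [Group C'] {E : GroupExtension (Multiplicative (HTwo P A)) C P}
    {E' : GroupExtension (Multiplicative (HTwo P A)) C' P} (hE : IsACentralExtension a E)
    (hE' : IsACentralExtension a E') : Nonempty (E.Equiv E') := by
  obtain ⟨n, hn, hA⟩ := hP.exists_int
  let σ := E.surjInvRightHom
  let σ' := E'.surjInvRightHom
  obtain ⟨z, hz⟩ := σ.exists_factorSet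
  obtain ⟨z', hz'⟩ := σ'.exists_factorSet
  obtain ⟨b, hb⟩ := exists_coboundary_of_chainPairing_eq hn (HTwo.zsmul_eq_self hA)
    (z := z) (z' := z') fun x hx => by
      rw [chainPairing_apply, chainPairing_apply]
      exact (hE'.2 σ' z' hz' ⟨x, hx⟩).symm.trans (hE.2 σ z hz ⟨x, hx⟩)
  exact hE.1.nonempty_equiv hE'.1 σ σ' z z' hz hz' b hb

/-- The isomorphism of `H₂(P, A)` induced by an automorphism of `P`. -/
noncomputable def HTwo.mapEquiv (A : Type) [AddCommGroup A] (α : MulAut P) :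
    HTwo P A ≃+ HTwo P A where
  __ := HTwo.map α.toMonoidHom (AddMonoidHom.id A)
  invFun := HTwo.map (α⁻¹ : MulAut P).toMonoidHom (AddMonoidHom.id A)
  left_inv x := by
    refine (HTwo.map_map α.toMonoidHom (α⁻¹ : MulAut P).toMonoidHom (AddMonoidHom.id A)
      (AddMonoidHom.id A) x).symm.trans ?_
    convert HTwo.map_id x
    · ext g
      exact α.symm_apply_apply g
    · rfl
  right_inv x := by
    refine (HTwo.map_map (α⁻¹ : MulAut P).toMonoidHom α.toMonoidHom (AddMonoidHom.id A)
      (AddMonoidHom.id A) x).symm.trans ?_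
    convert HTwo.map_id x
    · ext g
      exact α.apply_symm_apply g
    · rfl

lemma HTwo.mapEquiv_apply (α : MulAut P) (x : HTwo P A) :
    HTwo.mapEquiv A α x = HTwo.map α.toMonoidHom (AddMonoidHom.id A) x := rfl

/-- Pairing a cochain `z` with the image of a cycle under `α` amounts to pairing `z ∘ (α × α)` with
the cycle. -/
lemma HTwo.map_mk_pairing {M : Type*} [AddCommGroup M] (α : MulAut P)
    (x : groupHomology.cycles₂ (Rep.trivial ℤ P ℤ)) :
    ∃ y : groupHomology.cycles₂ (Rep.trivial ℤ P ℤ),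
      HTwo.map α.toMonoidHom (AddMonoidHom.id ℤ) (HTwo.mk x) = HTwo.mk y ∧
      ∀ z : P → P → M, chainPairing z y.1 = chainPairing (fun g h => z (α g) (α h)) x.1 := by
  refine ⟨_, HTwo.map_mk _ _ _, fun z => ?_⟩
  have : ((groupHomology.mapCycles₂ (A := Rep.trivial ℤ P ℤ)
      (B := Rep.trivial ℤ P ℤ) α.toMonoidHom
      (Rep.ofHom ⟨(AddMonoidHom.id ℤ).toIntLinearMap, fun _ => rfl⟩)).hom x).1 =
      Finsupp.mapDomain (Prod.map α α) x.1 := by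
    refine (groupHomology.coe_mapCycles₂ (A := Rep.trivial ℤ P ℤ)
      (B := Rep.trivial ℤ P ℤ) α.toMonoidHom
      (Rep.ofHom ⟨(AddMonoidHom.id ℤ).toIntLinearMap, fun _ => rfl⟩) x).trans ?_
    refine Finsupp.mapRange_id _
  refine (congrArg (chainPairing z) this).trans ?_
  exact Finsupp.linearCombination_mapDomain ℤ _ _

/-- By uniqueness of the `a`-central extension, every automorphism of `P` lifts to it. -/
lemma IsACentralExtension.exists_mulAut [Finite P] [AddGroup.FG A] (hP : IsAPerfect P A) {a : A}
    {C : Type*} [Group C] {E : GroupExtension (Multiplicative (HTwo P A)) C P}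
    (hE : IsACentralExtension a E) (α : MulAut P) :
    ∃ β : MulAut C, (∀ c, E.rightHom (β c) = α (E.rightHom c)) ∧
      ∀ m, β (E.inl (Multiplicative.ofAdd m)) = E.inl (Multiplicative.ofAdd
        (HTwo.map α.toMonoidHom (AddMonoidHom.id A) m)) := by
  let μ := HTwo.mapEquiv A α
  -- `E` with its two maps twisted by `α` is again an `a`-central extension
  let E' : GroupExtension (Multiplicative (HTwo P A)) C P :=
    { inl := E.inl.comp μ.toMultiplicative.toMonoidHom
      rightHom := (α⁻¹ : MulAut P).toMonoidHom.comp E.rightHom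
      inl_injective := E.inl_injective.comp μ.toMultiplicative.injective
      range_inl_eq_ker_rightHom := by
        have h1 : (E.inl.comp μ.toMultiplicative.toMonoidHom).range = E.inl.range := by
          ext c
          exact ⟨fun ⟨m, hm⟩ => ⟨_, hm⟩, fun ⟨m, hm⟩ => ⟨μ.toMultiplicative.symm m, by
            rw [← hm]
            exact congrArg E.inl (μ.toMultiplicative.apply_symm_apply m)⟩⟩
        rw [h1, E.range_inl_eq_ker_rightHom]
        ext c
        simp [MonoidHom.mem_ker]
      rightHom_surjective := (α⁻¹ : MulAut P).surjective.comp E.rightHom_surjective }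
  have hcen : E'.IsCentral := by
    rintro _ ⟨m, rfl⟩
    exact hE.1 ⟨_, rfl⟩
  have hE' : IsACentralExtension a E' := by
    refine ⟨hcen, fun σ' z' hz' x => μ.injective ?_⟩
    obtain ⟨y, hy, hxy⟩ := HTwo.map_mk_pairing (M := HTwo P A) α x
    let z : P → P → HTwo P A := fun g h => μ (z' (α⁻¹ g) (α⁻¹ h))
    let σ : E.Section := ⟨fun g => σ' (α⁻¹ g), fun g => α⁻¹.injective
      (σ'.rightHom_section (α⁻¹ g))⟩
    have h1 := hE.2 σ z (fun g h => by
      refine (hz' _ _).trans ?_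
      rw [← map_mul]
      rfl) y
    -- the map induced by `a` commutes with that of `α`: both composites are induced by `(α, a)`
    rw [← chainPairing_apply, hxy, ← hy, ← HTwo.map_map] at h1
    rw [← chainPairing_apply, HTwo.mapEquiv_apply, ← HTwo.map_map]
    have h2 : chainPairing (fun g h => z (α g) (α h)) =
        μ.toAddMonoidHom.toIntLinearMap ∘ₗ chainPairing z' := by
      ext gh
      simp [chainPairing, z]
    refine Eq.trans ?_ (h1.trans congr($h2 x.1))
    congr 2
  obtain ⟨e⟩ := hE.nonempty_equiv hP hE'
  refine ⟨(e : C ≃* C), fun c => ?_, fun m => ?_⟩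
  · have h : α⁻¹ (E.rightHom (e c)) = E.rightHom c := e.rightHom_map c
    rw [← h]
    exact (MulAut.apply_inv_self _ α _).symm
  · exact e.map_inl _

end aCentral

/-! ### The crossed module of the `a`-central extension -/

section action

variable {G A C : Type} {H : Type*} [Group G] [Group H] [AddCommGroup A] [Group C] {f : G →* H}
  {E : GroupExtension (Multiplicative (HTwo f.ker A)) C f.ker} {a : A}

/-- Equivalences of `a`-central extensions respect compatible actions; with the identity
equivalence, this is the uniqueness of the compatible action. -/
lemma IsCompatibleAction.eq_of_equiv [Finite G] [AddGroup.FG A] (hP : IsAPerfect f.ker A)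
    (hE : E.IsCentral) {C' : Type} [Group C']
    {E' : GroupExtension (Multiplicative (HTwo f.ker A)) C' f.ker} {act : G →* MulAut C}
    {act' : G →* MulAut C'} (h : IsCompatibleAction E act) (h' : IsCompatibleAction E' act')
    (e : E.Equiv E') (g : G) (c : C) : e (act g c) = act' g (e c) := by
  obtain ⟨n, hn, hA⟩ := hP.exists_int
  have key : (act g).toMonoidHom =
      ((e.symm : C' ≃* C).toMonoidHom.comp (act' g).toMonoidHom).comp (e : C ≃* C').toMonoidHom := by
    refine hE.hom_ext hn (HTwo.zsmul_eq_self hA) (fun m => ?_) fun c => ?_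
    · change act g (E.inl m) = e.symm (act' g (e (E.inl m)))
      rw [e.map_inl]
      refine (h.act_inl g m.toAdd).trans ?_
      rw [← e.symm.map_inl]
      exact congrArg e.symm (h'.act_inl g m.toAdd).symm
    · change E.rightHom (act g c) = E.rightHom (e.symm (act' g (e c)))
      rw [h.rightHom_act, e.symm.rightHom_map, h'.rightHom_act, e.rightHom_map]
  have := congr(e ($key c))
  exact this.trans (e.apply_symm_apply _)

/-- The crossed module structure: each `g` acts by the unique lift of its conjugation action, and
uniqueness gives both multiplicativity and the Peiffer identity. -/
lemma IsACentralExtension.existsUnique_act [Finite G] [AddGroup.FG A] (hP : IsAPerfect f.ker A)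
    (hE : IsACentralExtension a E) :
    ∃! act : G →* MulAut C, IsCompatibleAction E act ∧ IsCrossedModule (boundary E) act := by
  obtain ⟨n, hn, hA⟩ := hP.exists_int
  have hM := HTwo.zsmul_eq_self (P := f.ker) hA
  have uniq {α β : MulAut C}
      (hr : ∀ c, E.rightHom (α c) = E.rightHom (β c))
      (hl : ∀ m, α (E.inl m) = β (E.inl m)) : α = β := by
    ext c
    exact congr($(hE.1.hom_ext hn hM (α := α.toMonoidHom) (β := β.toMonoidHom) hl hr) c)
  choose β hβr hβl using fun g : G => hE.exists_mulAut hP (MulAut.conjNormal g)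
  let act : G →* MulAut C := MonoidHom.mk' β fun g g' => by
    refine uniq (fun c => ?_) fun m => ?_
    · rw [MulAut.mul_apply, hβr, hβr, hβr, map_mul, MulAut.mul_apply]
    · refine (hβl _ m.toAdd).trans ?_
      rw [MulAut.mul_apply]
      refine Eq.trans ?_ (congrArg (β g) (hβl g' m.toAdd)).symm
      rw [hβl]
      exact congr(E.inl (Multiplicative.ofAdd ($(map_mul (conjAction f A) g g') m.toAdd)))
  have hact : IsCompatibleAction E act := ⟨hβr, hβl⟩
  refine ⟨act, ⟨hact, fun g c => ?_, fun c c' => ?_⟩, fun act' h' => ?_⟩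
  · exact congrArg Subtype.val (hβr g c)
  · have : β (boundary E c) = MulAut.conj c := by
      refine uniq (fun c' => ?_) fun m => ?_
      · rw [hβr, MulAut.conj_apply, map_mul, map_mul, map_inv]
        ext
        simp [boundary]
      · refine (hβl _ m.toAdd).trans ?_
        rw [MulAut.conj_apply, hE.1.commute, mul_inv_cancel_right]
        exact congr(E.inl (Multiplicative.ofAdd
          ($(conjAction_ker f A (E.rightHom c)) m.toAdd)))
    exact congr($this c')
  · ext g c
    exact h'.1.eq_of_equiv hP hE.1 hact (GroupExtension.Equiv.refl E) g c

lemma mem_range_boundary (g : G) (hg : f g = 1) : ∃ c, boundary E c = g := by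
  obtain ⟨c, hc⟩ := E.rightHom_surjective ⟨g, hg⟩
  exact ⟨c, congrArg Subtype.val hc⟩

lemma ker_boundary_le : (boundary E).ker ≤ E.inl.range := by
  rw [E.range_inl_eq_ker_rightHom]
  exact fun c hc => Subtype.ext hc

/-- Any section `s` and any lift `F` yield a characteristic cocycle, as `ˢ⁽ʰ⁾F(k, l) F(h, kl)` and
`F(h, k) F(hk, l)` have the same image `s(h) s(k) s(l) s(hkl)⁻¹` in `G`. -/
lemma exists_isCharacteristicCocycle {act : G →* MulAut C} (hf : Function.Surjective f)
    (hd : IsCrossedModule (boundary E) act) :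
    ∃ c, IsCharacteristicCocycle E.inl (boundary E) act f c := by
  let s := Function.surjInv hf
  have hs (h : H) : f (s h) = h := Function.surjInv_eq hf h
  have hF (h k : H) : ∃ x, boundary E x = s h * s k * (s (h * k))⁻¹ :=
    mem_range_boundary _ (by simp [hs])
  choose F hF using hF
  have hc (h k l : H) :
      ∃ m, E.inl m = act (s h) (F k l) * F h (k * l) * (F h k * F (h * k) l)⁻¹ :=
    ker_boundary_le (MonoidHom.mem_ker.2 (by
      simp only [map_mul, map_inv, hd.equivariant, hF, mul_assoc h]
      group))
  choose c hc using hc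
  refine ⟨fun h k l => (c h k l).toAdd, s, F, hs, fun h k => ?_, fun h k l => ?_⟩
  · rw [hF, inv_mul_cancel_right]
  · rw [mul_assoc (E.inl _)]
    exact (eq_mul_inv_iff_mul_eq.1 (hc h k l)).symm

/-- The set of characteristic cocycles depends only on the equivalence class of the extension. -/
lemma IsCharacteristicCocycle.of_equiv [Finite G] [AddGroup.FG A] (hP : IsAPerfect f.ker A)
    (hE : E.IsCentral) {C' : Type} [Group C']
    {E' : GroupExtension (Multiplicative (HTwo f.ker A)) C' f.ker} {act : G →* MulAut C}
    {act' : G →* MulAut C'} (h : IsCompatibleAction E act) (h' : IsCompatibleAction E' act')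
    (e : E.Equiv E') {c : H → H → H → HTwo f.ker A}
    (hc : IsCharacteristicCocycle E.inl (boundary E) act f c) :
    IsCharacteristicCocycle E'.inl (boundary E') act' f c := by
  obtain ⟨s, F, hs, hF, hc⟩ := hc
  refine ⟨s, fun h k => e (F h k), hs, fun h k => ?_, fun k l m => ?_⟩
  · rw [hF]
    congr 1
    exact congrArg Subtype.val (e.rightHom_map (F h k)).symm
  · rw [← h.eq_of_equiv hP hE h' e, ← map_mul, hc, map_mul, map_mul, e.map_inl]

end action

section obstruction

variable {G A C : Type} {H : Type v} [Group G] [Group H] [AddCommGroup A] [Group C] {f : G →* H}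
  {E : GroupExtension (Multiplicative (HTwo f.ker A)) C f.ker} {act : G →* MulAut C}

lemma IsCompatibleAction.act_inl_eq (h : IsCompatibleAction E act) (hf : Function.Surjective f)
    (g : G) (m : HTwo f.ker A) : act g (E.inl (Multiplicative.ofAdd m)) =
      E.inl (Multiplicative.ofAdd (outerAction f A hf (f g) m)) := by
  rw [h.act_inl, outerAction_apply]

variable [TopologicalSpace H] [IsTopologicalGroup H]

lemma IsCharacteristicCocycle.exists_class [DiscreteTopology H] (hf : Function.Surjective f)
    (hE : E.IsCentral) (h : IsCompatibleAction E act) (hd : IsCrossedModule (boundary E) act)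
    {c : H → H → H → HTwo f.ker A}
    (hc : IsCharacteristicCocycle E.inl (boundary E) act f c) :
    ∃ x, IsClassOfCocycle (X := coeffModule f A hf) (fun h k l => ULift.up (c h k l)) x := by
  obtain ⟨s, F, hs, hF, hc⟩ := hc
  refine exists_isClassOfCocycle _ fun g k l m => congrArg ULift.up ?_
  exact hd.isCocycle (ρ := fun g => outerAction f A hf g) E.inl_injective hE
    (fun g m => by rw [h.act_inl_eq hf, hs]) hF hc g k l m

/-- Restricted along a homomorphism `φ : K → H`, the class of a characteristic cocycle can be
computed from any lift `s'` of `φ` to a function `K → G`. -/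
lemma IsCharacteristicCocycle.isClassOfCocycle_res {K : Type v} [Group K] [TopologicalSpace K]
    [DiscreteTopology K] [IsTopologicalGroup K] (φ : K →ₜ* H) (hf : Function.Surjective f)
    (hE : E.IsCentral) (h : IsCompatibleAction E act) (hd : IsCrossedModule (boundary E) act)
    {c : H → H → H → HTwo f.ker A}
    (hc : IsCharacteristicCocycle E.inl (boundary E) act f c)
    {x : HThree (coeffModule f A hf)}
    (hx : IsClassOfCocycle (X := coeffModule f A hf) (fun h k l => ULift.up (c h k l)) x)
    {s' : K → G} {F' : K → K → C} {c' : K → K → K → HTwo f.ker A} (hs' : ∀ k, f (s' k) = φ k)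
    (hF' : ∀ h k, s' h * s' k = boundary E (F' h k) * s' (h * k))
    (hc' : ∀ h k l, act (s' h) (F' k l) * F' h (k * l) =
      E.inl (Multiplicative.ofAdd (c' h k l)) * F' h k * F' (h * k) l) :
    IsClassOfCocycle (X := TopRep.res (φ : K →* H) (coeffModule f A hf))
      (fun h k l => ULift.up (c' h k l)) (pullback φ (coeffModule f A hf) x) := by
  obtain ⟨s, F, hs, hF, hc⟩ := hc
  obtain ⟨e, he⟩ := hd.exists_coboundary (ρ := fun k : K => outerAction f A hf (φ k))
    (s := fun k => s (φ k)) (F := fun h k => F (φ h) (φ k))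
    (c := fun h k l => c (φ h) (φ k) (φ l)) E.inl_injective hE ker_boundary_le
    (fun g m => by rw [h.act_inl_eq hf, hs]) (fun h k => by rw [map_mul, hF])
    (fun h k l => by rw [map_mul, map_mul, hc]) hF' hc' (fun k => by
      obtain ⟨b, hb⟩ := mem_range_boundary (E := E) (s' k * (s (φ k))⁻¹) (by simp [hs, hs'])
      exact ⟨b, by rw [hb, inv_mul_cancel_right]⟩)
  exact (hx.pullback φ).of_coboundary (fun h k => ULift.up (e h k))
    fun h k l => congrArg ULift.up (he h k l)

end obstruction

/-! ### Independence of choices and vanishing of the class -/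

section vanishing

variable {G A C : Type} {H : Type v} [Group G] [Group H] [AddCommGroup A] [Group C] {f : G →* H}
  {E : GroupExtension (Multiplicative (HTwo f.ker A)) C f.ker} {act : G →* MulAut C}
  [TopologicalSpace H] [IsTopologicalGroup H]

lemma pullback_id (X : TopRep.{v} ℤ H) (x : HThree X) :
    pullback (ContinuousMonoidHom.id H) X x = x :=
  congr(($(ContinuousCohomology.map_id X 3)).hom x)

/-- All characteristic cocycles of a crossed module have the same class. -/
lemma IsCharacteristicCocycle.isClassOfCocycle [DiscreteTopology H] (hf : Function.Surjective f)
    (hE : E.IsCentral) (h : IsCompatibleAction E act) (hd : IsCrossedModule (boundary E) act)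
    {c c' : H → H → H → HTwo f.ker A}
    (hc : IsCharacteristicCocycle E.inl (boundary E) act f c)
    (hc' : IsCharacteristicCocycle E.inl (boundary E) act f c')
    {x : HThree (coeffModule f A hf)}
    (hx : IsClassOfCocycle (X := coeffModule f A hf) (fun h k l => ULift.up (c h k l)) x) :
    IsClassOfCocycle (X := coeffModule f A hf) (fun h k l => ULift.up (c' h k l)) x := by
  obtain ⟨s', F', hs', hF', hc'⟩ := hc'
  have := hc.isClassOfCocycle_res (ContinuousMonoidHom.id H) hf hE h hd hx hs' hF' hc'
  rw [pullback_id] at this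
  exact this

/-- The class vanishes along `φ` as soon as `φ` lifts to a homomorphism `K → G`: that lift has the
trivial factor set, hence the zero characteristic cocycle. -/
lemma IsCharacteristicCocycle.pullback_eq_zero {K : Type v} [Group K] [TopologicalSpace K]
    [DiscreteTopology K] [IsTopologicalGroup K] (φ : K →ₜ* H) (hf : Function.Surjective f)
    (hE : E.IsCentral) (h : IsCompatibleAction E act) (hd : IsCrossedModule (boundary E) act)
    {c : H → H → H → HTwo f.ker A}
    (hc : IsCharacteristicCocycle E.inl (boundary E) act f c)
    {x : HThree (coeffModule f A hf)}
    (hx : IsClassOfCocycle (X := coeffModule f A hf) (fun h k l => ULift.up (c h k l)) x)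
    (t : K →* G) (ht : ∀ k, f (t k) = φ k) : pullback φ (coeffModule f A hf) x = 0 :=
  (hc.isClassOfCocycle_res φ hf hE h hd hx (s' := t) (F' := fun _ _ => 1) (c' := fun _ _ _ => 0)
    ht (fun h k => by simp) (fun h k l => by simp)).eq
    (isClassOfCocycle_zero (TopRep.res (φ : K →* H) (coeffModule f A hf)))

end vanishing

theorem mainTheorem8 {Γ H : Type v} {G A : Type}
    [Group Γ] [TopologicalSpace Γ] [IsTopologicalGroup Γ]
    [CompactSpace Γ] [T2Space Γ] [TotallyDisconnectedSpace Γ]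
    [Group G] [Finite G] [TopologicalSpace G] [DiscreteTopology G]
    [Group H] [Finite H] [TopologicalSpace H] [DiscreteTopology H]
    [AddCommGroup A] [AddGroup.FG A] (a : A)
    (f : G →* H) (hf : Function.Surjective f) (p : Γ →ₜ* H)
    (hP : IsAPerfect f.ker A) :
    -- existence and uniqueness of the `a`-central extension
    (∃ (C : Type) (_ : Group C) (E : GroupExtension (Multiplicative (HTwo f.ker A)) C f.ker),
      IsACentralExtension a E) ∧
    (∀ (C C' : Type) [Group C] [Group C']
      (E : GroupExtension (Multiplicative (HTwo f.ker A)) C f.ker)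
      (E' : GroupExtension (Multiplicative (HTwo f.ker A)) C' f.ker),
      IsACentralExtension a E → IsACentralExtension a E' → Nonempty (E.Equiv E')) ∧
    -- the crossed module `C → G`
    (∀ (C : Type) [Group C] (E : GroupExtension (Multiplicative (HTwo f.ker A)) C f.ker),
      IsACentralExtension a E →
        ∃! act : G →* MulAut C,
          IsCompatibleAction E act ∧ IsCrossedModule (boundary E) act) ∧
    -- its class `o`, which is an obstruction
    ∃ o : HThree (coeffModule f A hf),
      (∀ (C : Type) [Group C] (E : GroupExtension (Multiplicative (HTwo f.ker A)) C f.ker)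
        (act : G →* MulAut C), IsACentralExtension a E → IsCompatibleAction E act →
        IsCrossedModule (boundary E) act → ∀ x, IsClassifiedBy hf E act x ↔ x = o) ∧
      ((∃ s : H →* G, ∀ h, f (s h) = h) → o = 0) ∧
      (HasWeakSolution p f → pullback p (coeffModule f A hf) o = 0) := by
  obtain ⟨C₀, _, E₀, hE₀⟩ := exists_isACentralExtension (P := f.ker) a
  obtain ⟨act₀, ⟨hact₀, hd₀⟩, -⟩ := hE₀.existsUnique_act hP
  obtain ⟨c₀, hc₀⟩ := exists_isCharacteristicCocycle hf hd₀
  obtain ⟨o, ho⟩ := hc₀.exists_class hf hE₀.1 hact₀ hd₀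
  refine ⟨⟨C₀, _, E₀, hE₀⟩, fun C C' _ _ E E' hE hE' => hE.nonempty_equiv hP hE',
    fun C _ E hE => hE.existsUnique_act hP, o, fun C _ E act hE hact hd x => ?_, ?_, ?_⟩
  · obtain ⟨e⟩ := hE.nonempty_equiv hP hE₀
    have key {c} (hc : IsCharacteristicCocycle E.inl (boundary E) act f c) :
        IsClassOfCocycle (X := coeffModule f A hf) (fun h k l => ULift.up (c h k l)) o :=
      hc₀.isClassOfCocycle hf hE₀.1 hact₀ hd₀ (hc.of_equiv hP hE.1 hact hact₀ e) ho
    constructor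
    · rintro ⟨⟨c, hc⟩, h⟩
      exact (h c hc).eq (key hc)
    · rintro rfl
      exact ⟨exists_isCharacteristicCocycle hf hd, fun c hc => key hc⟩
  · rintro ⟨s, hs⟩
    have := hc₀.pullback_eq_zero (ContinuousMonoidHom.id H) hf hE₀.1 hact₀ hd₀ ho s hs
    rwa [pullback_id] at this
  · rintro ⟨q, hq⟩
    -- `p` factors through the discrete group `G`, lifted to the universe of `Γ`
    let φ : ULift.{v} G →ₜ* H :=
      ⟨f.comp MulEquiv.ulift.toMonoidHom, continuous_of_discreteTopology⟩
    let q' : Γ →ₜ* ULift.{v} G :=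
      ⟨MulEquiv.ulift.symm.toMonoidHom.comp (q : Γ →* G), continuous_uliftUp.comp q.continuous⟩
    have hp : p = φ.comp q' := by
      ext γ
      exact (hq γ).symm
    have h0 := hc₀.pullback_eq_zero φ hf hE₀.1 hact₀ hd₀ ho MulEquiv.ulift.toMonoidHom
      fun _ => rfl
    subst hp
    have h1 := congr(($(ContinuousCohomology.map_comp φ q'
      (𝟙 (TopRep.res (φ : ULift.{v} G →* H) (coeffModule f A hf)))
      (𝟙 (TopRep.res (q' : Γ →* ULift.{v} G)
        (TopRep.res (φ : ULift.{v} G →* H) (coeffModule f A hf)))) 3)).hom o)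
    refine h1.trans ?_
    exact (congrArg (pullback q' _) h0).trans (map_zero _)
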